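/- For a permutation $\pi=\pi_1\cdots\pi_n$ of $\{1,\dots,n\}$ let $\mathrm{exc}(\pi)=|\{i:\pi_i>i\}|$ and $\mathrm{maj}(\pi)=\sum_{1\le i<n,\ \pi_i>\pi_{i+1}} i$, and define $$A_n(t,q)=\sum_{\pi\in\mathfrak S_n}t^{\mathrm{exc}(\pi)}q^{\mathrm{maj}(\pi)-\mathrm{exc}(\pi)},\qquad \tilde A_n(t,q)=1+t\sum_{m=1}^n{n\brack m}_qA_m(t,q)\quad(n\ge 0),$$ where ${n\brack m}_q=\dfrac{(q;q)_n}{(q;q)_m(q;q)_{n-m}}$ and $(q;q)_n=\prod_{i=1}^n(1-q^i)$; the $q$-binomial coefficient ${n\brack m}_q$ is a polynomial in $q$, and $A_n(t,q)$, $\tilde A_n(t,q)$ are polynomials in $t$ and $q$, so they may be evaluated at $q=-1$. Then for every integer $n\ge 0$ the following identities of polynomials in $t$ hold: $$\tilde A_{2n+1}(t,-1)=(1+t)\tilde A_{2n}(t,-1)+t\sum_{k=1}^n\binom nk A_{2k}(t,-1)\tilde A_{2n-2k}(t,-1)$$ and $$\tilde A_{2n+2}(t,-1)=(1+t)\tilde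 A_{2n+1}(t,-1)+t\sum_{k=1}^n\binom nk A_{2k}(t,-1)\tilde A_{2n+1-2k}(t,-1)-t\sum_{k=0}^n\binom nk A_{2k+1}(t,-1)\tilde A_{2n-2k}(t,-1).$$ -/

import Mathlib

open Polynomial

noncomputable section

/-- Positions at which a permutation of `Fin n` has a descent. The (0-based) position `i` in
`Fin n` stands for the position `i + 1` in `{1, …, n}`. -/
def descentSet {n : ℕ} (π : Equiv.Perm (Fin n)) : Finset (Fin n) :=
  Finset.univ.filter fun i => ∃ h : (i : ℕ) + 1 < n, π ⟨(i : ℕ) + 1, h⟩ < π i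

/-- The major index: the sum of the 1-based descent positions. -/
def maj {n : ℕ} (π : Equiv.Perm (Fin n)) : ℕ :=
  ∑ i ∈ descentSet π, ((i : ℕ) + 1)

/-- The number of excedances. (The last position is never an excedance.) -/
def exc {n : ℕ} (π : Equiv.Perm (Fin n)) : ℕ :=
  (Finset.univ.filter fun i : Fin n => i < π i).card

/-- The subtraction `maj π - exc π` of natural numbers never truncates. -/
theorem exc_le_maj {n : ℕ} (π : Equiv.Perm (Fin n)) : exc π ≤ maj π := by
  -- an excedance position is at most some descent position
  have key : ∀ m : ℕ, ∀ i : Fin n, n - (i : ℕ) ≤ m → i < π i →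
      ∃ d ∈ descentSet π, i ≤ d := by
    intro m
    induction m with
    | zero => intro i hm _; have := i.2; omega
    | succ m ih =>
      intro i hm hi
      have h1 : (i : ℕ) < (π i : ℕ) := hi
      have h2 := (π i).2
      have h : (i : ℕ) + 1 < n := by omega
      by_cases hd : π ⟨(i : ℕ) + 1, h⟩ < π i
      · exact ⟨i, by simp only [descentSet, Finset.mem_filter, Finset.mem_univ, true_and]
                     exact ⟨h, hd⟩, le_rfl⟩
      · have hne : π ⟨(i : ℕ) + 1, h⟩ ≠ π i := fun e => by
          have := congrArg Fin.val (π.injective e)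
          simp at this
        have hlt : π i < π ⟨(i : ℕ) + 1, h⟩ := lt_of_le_of_ne (not_lt.mp hd) hne.symm
        have hlt' : (π i : ℕ) < (π ⟨(i : ℕ) + 1, h⟩ : ℕ) := hlt
        obtain ⟨d, hd1, hd2⟩ := ih ⟨(i : ℕ) + 1, h⟩ (by simp only; omega)
          (by rw [Fin.lt_def]; simp only; omega)
        refine ⟨d, hd1, ?_⟩
        rw [Fin.le_def] at hd2 ⊢
        simp only at hd2
        omega
  have hsub : (Finset.univ.filter fun i : Fin n => i < π i) ⊆
      (descentSet π).biUnion fun d => Finset.Iic d := by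
    intro i hi
    obtain ⟨d, h1, h2⟩ := key _ i le_rfl (by simpa using hi)
    exact Finset.mem_biUnion.2 ⟨d, h1, Finset.mem_Iic.2 h2⟩
  calc exc π ≤ ((descentSet π).biUnion fun d => Finset.Iic d).card := Finset.card_le_card hsub
    _ ≤ ∑ d ∈ descentSet π, (Finset.Iic d).card := Finset.card_biUnion_le
    _ = maj π := by simp [maj]

/-- The `(maj, exc)`-Eulerian polynomial `A_n(t,q) = ∑_π t^{exc π} q^{maj π - exc π}`, as a
polynomial in `t` (outer variable) with coefficients in `ℝ[q]`. -/
def qEulerian (n : ℕ) : ℝ[X][X] :=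
  ∑ π : Equiv.Perm (Fin n), X ^ exc π * C (X ^ (maj π - exc π))

/-- `(q;q)_n = ∏_{i=1}^n (1 - q^i)`. -/
def qPoch (n : ℕ) : ℝ[X] :=
  ∏ i ∈ Finset.Icc 1 n, (1 - X ^ i)

/-- The `q`-binomial coefficient `(q;q)_n / ((q;q)_m (q;q)_{n-m})` for `m ≤ n`; the division in
`ℝ[q]` is exact, see `qBinom_mul`. -/
def qBinom (n m : ℕ) : ℝ[X] :=
  qPoch n / (qPoch m * qPoch (n - m))

theorem qPoch_succ (n : ℕ) : qPoch (n + 1) = qPoch n * (1 - X ^ (n + 1)) := by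
  rw [qPoch, Finset.prod_Icc_succ_top (by omega)]; rfl

theorem qPoch_mul_dvd (k l : ℕ) : qPoch k * qPoch l ∣ qPoch (k + l) := by
  induction k generalizing l with
  | zero => simp [qPoch]
  | succ k ihk =>
    induction l with
    | zero => simp [qPoch]
    | succ l ihl =>
      obtain ⟨a, ha⟩ := ihk (l + 1)
      obtain ⟨b, hb⟩ := ihl
      have e1 : k + (l + 1) = k + 1 + l := by ring
      rw [e1] at ha
      refine ⟨a + X ^ (k + 1) * b, ?_⟩
      have e2 : k + 1 + (l + 1) = (k + 1 + l) + 1 := by ring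
      have e3 : (1 - X ^ (k + 1 + l + 1) : ℝ[X])
          = (1 - X ^ (k + 1)) + X ^ (k + 1) * (1 - X ^ (l + 1)) := by ring
      calc qPoch (k + 1 + (l + 1))
          = qPoch (k + 1 + l) * (1 - X ^ (k + 1))
            + X ^ (k + 1) * (1 - X ^ (l + 1)) * qPoch (k + 1 + l) := by
              rw [e2, qPoch_succ, e3]; ring
        _ = qPoch k * qPoch (l + 1) * a * (1 - X ^ (k + 1))
            + X ^ (k + 1) * (1 - X ^ (l + 1)) * (qPoch (k + 1) * qPoch l * b) := by
              rw [← ha, ← hb]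
        _ = _ := by rw [qPoch_succ k, qPoch_succ l]; ring

theorem qPoch_ne_zero (n : ℕ) : qPoch n ≠ 0 := by
  refine Finset.prod_ne_zero_iff.2 fun i hi h => ?_
  have hi' : i ≠ 0 := by have := (Finset.mem_Icc.1 hi).1; omega
  have := congrArg (Polynomial.eval 0) h
  simp [hi'] at this

/-- The division that defines the `q`-binomial coefficient is exact. -/
theorem qBinom_mul {n m : ℕ} (h : m ≤ n) :
    qBinom n m * (qPoch m * qPoch (n - m)) = qPoch n := by
  have hd : qPoch m * qPoch (n - m) ∣ qPoch n := by
    have := qPoch_mul_dvd m (n - m)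
    rwa [Nat.add_sub_cancel' h] at this
  rw [qBinom, mul_comm]
  exact EuclideanDomain.mul_div_cancel' (mul_ne_zero (qPoch_ne_zero _) (qPoch_ne_zero _)) hd

/-- The `q`-binomial-Eulerian polynomial
`Ã_n(t,q) = 1 + t ∑_{m=1}^n [n choose m]_q A_m(t,q)`. -/
def qBinomEulerian (n : ℕ) : ℝ[X][X] :=
  1 + X * ∑ m ∈ Finset.Icc 1 n, C (qBinom n m) * qEulerian m

/-- The signed Eulerian polynomial `A_n(t,-1)`, a polynomial in `t`. -/
def signedEulerian (n : ℕ) : ℝ[X] :=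
  (qEulerian n).map (evalRingHom (-1))

/-- The signed binomial-Eulerian polynomial `Ã_n(t,-1)`, a polynomial in `t`. -/
def signedBinomEulerian (n : ℕ) : ℝ[X] :=
  (qBinomEulerian n).map (evalRingHom (-1))

end

noncomputable section

/-- The classical Eulerian polynomial, as the generating function of excedances. -/
def eulerianPoly (n : ℕ) : ℝ[X] :=
  ∑ σ : Equiv.Perm (Fin n), X ^ exc σ

theorem exc_eq_sum {n : ℕ} (π : Equiv.Perm (Fin n)) :
    exc π = ∑ i, if i < π i then 1 else 0 := by
  rw [exc, Finset.card_filter]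

theorem exc_decomposeFin_symm_zero {n : ℕ} (e : Equiv.Perm (Fin n)) :
    exc (Equiv.Perm.decomposeFin.symm (0, e)) = exc e := by
  rw [exc_eq_sum, Fin.sum_univ_succ, Equiv.Perm.decomposeFin_symm_apply_zero, exc_eq_sum]
  simp only [lt_self_iff_false, if_false, zero_add]
  refine Finset.sum_congr rfl fun x _ => ?_
  rw [Equiv.Perm.decomposeFin_symm_apply_succ, Equiv.swap_self, Equiv.refl_apply]
  simp only [Fin.succ_lt_succ_iff]

theorem exc_decomposeFin_symm_succ {n : ℕ} (e : Equiv.Perm (Fin n)) (j : Fin n) :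
    exc (Equiv.Perm.decomposeFin.symm ((e j).succ, e)) =
      exc e + if j < e j then 0 else 1 := by
  have key : (∑ x : Fin n, if x.succ < Equiv.Perm.decomposeFin.symm ((e j).succ, e) x.succ then 1 else 0 : ℕ)
      + (if j < e j then 1 else 0) = exc e := by
    rw [exc_eq_sum, ← Finset.add_sum_erase _ _ (Finset.mem_univ j),
      ← Finset.add_sum_erase Finset.univ (fun i => if i < e i then 1 else 0)
        (Finset.mem_univ j), add_comm _ (if j < e j then 1 else 0), ← add_assoc]
    congr 1
    · simp [Equiv.Perm.decomposeFin_symm_apply_succ]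
    · refine Finset.sum_congr rfl fun x hx => ?_
      rw [Equiv.Perm.decomposeFin_symm_apply_succ, Equiv.swap_apply_of_ne_of_ne]
      · simp
      · exact Fin.succ_ne_zero _
      · simpa using Finset.ne_of_mem_erase hx
  rw [exc_eq_sum, Fin.sum_univ_succ, Equiv.Perm.decomposeFin_symm_apply_zero,
    if_pos (Fin.succ_pos _)]
  split_ifs at key ⊢ <;> omega

theorem eulerianPoly_succ (n : ℕ) :
    eulerianPoly (n + 1) =
      (1 + (n : ℝ[X]) * X) * eulerianPoly n + X * (1 - X) * derivative (eulerianPoly n) := by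
  unfold eulerianPoly
  rw [← Equiv.sum_comp Equiv.Perm.decomposeFin.symm, Fintype.sum_prod_type_right,
     derivative_sum, Finset.mul_sum, Finset.mul_sum, ← Finset.sum_add_distrib]
  refine Finset.sum_congr rfl fun e _ => ?_
  have hX : (X : ℝ[X]) * derivative (X ^ exc e) = (exc e : ℝ[X]) * X ^ exc e := by
    rw [derivative_X_pow]
    rcases exc e with _ | k
    · simp
    · simp [pow_succ]; ring
  have hsum : ∑ j, (X : ℝ[X]) ^ (if j < e j then 0 else 1) =
      (exc e : ℝ[X]) + ((n : ℝ[X]) - (exc e : ℝ[X])) * (X : ℝ[X]) := by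
    have h : ∀ j, (X : ℝ[X]) ^ (if j < e j then 0 else 1) =
        X + ((if j < e j then 1 else 0 : ℕ) : ℝ[X]) * (1 - X) := by
      intro j; split_ifs <;> simp
    simp_rw [h]
    rw [Finset.sum_add_distrib, ← Finset.sum_mul, ← Nat.cast_sum, ← exc_eq_sum]
    simp
    ring
  rw [Fin.sum_univ_succ, exc_decomposeFin_symm_zero,
    ← Equiv.sum_comp e fun j => (X : ℝ[X]) ^ exc (Equiv.Perm.decomposeFin.symm (j.succ, e))]
  simp_rw [exc_decomposeFin_symm_succ, pow_add]
  rw [← Finset.mul_sum, hsum]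
  linear_combination (X - 1) * hX

theorem eulerianPoly_zero : eulerianPoly 0 = 1 := by
  simp [eulerianPoly, exc]

theorem eulerianPoly_one : eulerianPoly 1 = 1 := by
  simp [eulerianPoly_succ 0, eulerianPoly_zero]

/-- The exponential generating function of a sequence of polynomials. -/
def egf (f : ℕ → ℝ[X]) : PowerSeries ℝ[X] :=
  PowerSeries.mk fun n => C ((n.factorial : ℝ)⁻¹) * f n

theorem coeff_egf (f : ℕ → ℝ[X]) (n : ℕ) :
    PowerSeries.coeff n (egf f) = C ((n.factorial : ℝ)⁻¹) * f n := by
  exact PowerSeries.coeff_mk _ _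

theorem egf_injective : Function.Injective egf := by
  intro f g h
  funext n
  have hn := congrArg (PowerSeries.coeff n) h
  rw [coeff_egf, coeff_egf] at hn
  exact mul_left_cancel₀ (by simpa using n.factorial_ne_zero) hn

theorem egf_mul (f g : ℕ → ℝ[X]) :
    egf f * egf g =
      egf fun n => ∑ k ∈ Finset.range (n + 1), (n.choose k : ℝ[X]) * f k * g (n - k) := by
  ext1 n
  rw [PowerSeries.coeff_mul, coeff_egf, Finset.Nat.sum_antidiagonal_eq_sum_range_succ_mk,
    Finset.mul_sum]
  refine Finset.sum_congr rfl fun k hk => ?_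
  have hk : k ≤ n := Nat.lt_succ_iff.1 (Finset.mem_range.1 hk)
  have h : (n.choose k : ℝ[X]) = C (n.choose k : ℝ) := by simp
  have h' : ((k.factorial : ℝ)⁻¹) * ((n - k).factorial : ℝ)⁻¹ =
      (n.factorial : ℝ)⁻¹ * (n.choose k : ℝ) := by
    rw [Nat.cast_choose ℝ hk]
    have := n.factorial_ne_zero
    field_simp
  simp only [coeff_egf]
  rw [h]
  linear_combination (f k * g (n - k)) * congrArg C h'
    + (f k * g (n - k)) * (C_mul (a := (n.factorial : ℝ)⁻¹) (b := (n.choose k : ℝ)))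
    - (f k * g (n - k)) * (C_mul (a := (k.factorial : ℝ)⁻¹) (b := ((n-k).factorial : ℝ)⁻¹))

theorem egf_add (f g : ℕ → ℝ[X]) : egf (fun n => f n + g n) = egf f + egf g := by
  ext1 n; simp [coeff_egf, mul_add]

theorem egf_sub (f g : ℕ → ℝ[X]) : egf (fun n => f n - g n) = egf f - egf g := by
  ext1 n; simp [coeff_egf, mul_sub]

theorem egf_const_mul (c : ℝ[X]) (f : ℕ → ℝ[X]) :
    egf (fun n => c * f n) = PowerSeries.C c * egf f := by
  ext1 n; rw [PowerSeries.coeff_C_mul, coeff_egf, coeff_egf]; ring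

theorem inv_factorial_succ_mul (n : ℕ) :
    C (((n + 1).factorial : ℝ)⁻¹) * ((n : ℝ[X]) + 1) = C ((n.factorial : ℝ)⁻¹) := by
  have h : ((n : ℝ[X]) + 1) = C ((n : ℝ) + 1) := by simp
  rw [h, ← C_mul, Nat.factorial_succ]
  congr 1
  have : (n : ℝ) + 1 ≠ 0 := by positivity
  have := n.factorial_ne_zero
  push_cast
  field_simp

theorem derivative_egf (f : ℕ → ℝ[X]) :
    PowerSeries.derivative ℝ[X] (egf f) = egf fun n => f (n + 1) := by
  ext1 n
  rw [PowerSeries.coeff_derivative, coeff_egf, coeff_egf, ← inv_factorial_succ_mul n]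
  ring

theorem derivative_powerSeries_mul {R : Type*} [CommRing R] (f g : PowerSeries R) :
    PowerSeries.derivative R (f * g) =
      f * PowerSeries.derivative R g + g * PowerSeries.derivative R f := by
  rw [Derivation.leibniz]; rfl

/-- Differentiation of the coefficients of a power series over a polynomial ring. -/
def coeffDerivative (f : PowerSeries ℝ[X]) : PowerSeries ℝ[X] :=
  PowerSeries.mk fun n => derivative (PowerSeries.coeff n f)

theorem coeff_coeffDerivative (f : PowerSeries ℝ[X]) (n : ℕ) :
    PowerSeries.coeff n (coeffDerivative f) = derivative (PowerSeries.coeff n f) := by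
  simp [coeffDerivative]

theorem coeffDerivative_sub (f g : PowerSeries ℝ[X]) :
    coeffDerivative (f - g) = coeffDerivative f - coeffDerivative g := by
  ext1 n; simp [coeff_coeffDerivative]

theorem coeffDerivative_mul (f g : PowerSeries ℝ[X]) :
    coeffDerivative (f * g) = coeffDerivative f * g + f * coeffDerivative g := by
  ext1 n
  simp only [coeff_coeffDerivative, PowerSeries.coeff_mul, map_add, map_sum, derivative_mul,
    Finset.sum_add_distrib]

theorem coeffDerivative_C (p : ℝ[X]) :
    coeffDerivative (PowerSeries.C p) = PowerSeries.C (derivative p) := by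
  ext1 n
  simp only [coeff_coeffDerivative, PowerSeries.coeff_C]
  split_ifs <;> simp

theorem derivative_coeffDerivative (f : PowerSeries ℝ[X]) :
    PowerSeries.derivative ℝ[X] (coeffDerivative f) =
      coeffDerivative (PowerSeries.derivative ℝ[X] f) := by
  ext1 n
  simp only [coeff_coeffDerivative, PowerSeries.coeff_derivative, derivative_mul]
  simp

/-- The linear recurrence of the Eulerian polynomials as a partial differential equation. -/
theorem derivative_egf_eulerianPoly_linear :
    PowerSeries.derivative ℝ[X] (egf eulerianPoly) =
      egf eulerianPoly +
        PowerSeries.C X * PowerSeries.X * PowerSeries.derivative ℝ[X] (egf eulerianPoly) +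
        PowerSeries.C (X * (1 - X)) * coeffDerivative (egf eulerianPoly) := by
  ext1 n
  have h : PowerSeries.coeff n
      (PowerSeries.X * PowerSeries.derivative ℝ[X] (egf eulerianPoly)) =
        n * (C ((n.factorial : ℝ)⁻¹) * eulerianPoly n) := by
    cases n with
    | zero => simp
    | succ n =>
      rw [mul_comm, PowerSeries.coeff_succ_mul_X, PowerSeries.coeff_derivative, coeff_egf]
      push_cast; ring
  rw [derivative_egf, mul_assoc, ← derivative_egf, map_add, map_add, PowerSeries.coeff_C_mul, h,
    derivative_egf, PowerSeries.coeff_C_mul, coeff_coeffDerivative, coeff_egf, coeff_egf,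
    eulerianPoly_succ, derivative_C_mul]
  ring

theorem derivative_egf_eulerianPoly :
    PowerSeries.derivative ℝ[X] (egf eulerianPoly) =
      PowerSeries.C (1 - X) * egf eulerianPoly + PowerSeries.C X * egf eulerianPoly ^ 2 := by
  set E := egf eulerianPoly with hE
  set d := PowerSeries.derivative ℝ[X]
  set t : PowerSeries ℝ[X] := PowerSeries.C X with ht
  have h1 := derivative_egf_eulerianPoly_linear
  rw [← hE] at h1
  have hC : PowerSeries.C (1 - X : ℝ[X]) = 1 - t := by simp [ht]
  have hCC : PowerSeries.C (X * (1 - X) : ℝ[X]) = t * (1 - t) := by simp [ht]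
  have hdt : d t = 0 := PowerSeries.derivative_C
  have hdtt : d (t * (1 - t)) = 0 := hCC ▸ PowerSeries.derivative_C
  have hd : ∀ f g, d (f * g) = f * d g + g * d f := derivative_powerSeries_mul
  have hct : coeffDerivative t = 1 := by simp [ht, coeffDerivative_C]
  have hc1 : coeffDerivative (1 - t) = -1 := by
    rw [← hC, coeffDerivative_C]; simp
  rw [hC]
  set N := d E - (1 - t) * E - t * (E * E) with hN
  have h2 : d (d E) = d E + (t * d E + t * PowerSeries.X * d (d E)) +
      t * (1 - t) * coeffDerivative (d E) := by
    have := congrArg d h1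
    rw [map_add, map_add, hd, hd, hd,
      PowerSeries.derivative_C, PowerSeries.derivative_X, derivative_coeffDerivative, hCC, hdtt] at this
    linear_combination this
  have hdN : d N = d (d E) - (1 - t) * d E - t * (2 * (E * d E)) := by
    rw [hN, map_sub, map_sub, hd, hd, hd, hdt, ← hC, PowerSeries.derivative_C]
    ring
  have hcN : coeffDerivative N = coeffDerivative (d E) + E - (1 - t) * coeffDerivative E - E * E -
      t * (2 * (E * coeffDerivative E)) := by
    rw [hN, coeffDerivative_sub, coeffDerivative_sub, coeffDerivative_mul, coeffDerivative_mul,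
      coeffDerivative_mul, hct, hc1]
    ring
  have hLN : d N = t * (PowerSeries.X * d N) + t * ((1 - t) * coeffDerivative N) +
      (1 + t) * N := by
    rw [hCC] at h1
    rw [hdN, hcN, hN]
    linear_combination h2 - (1 - t + 2 * t * E) * h1
  have hzero : ∀ n, PowerSeries.coeff n N = 0 := by
    intro n
    induction n with
    | zero =>
      rw [hN, hE, derivative_egf, ← hC, ht, egf_mul]
      rw [map_sub, map_sub, PowerSeries.coeff_C_mul, PowerSeries.coeff_C_mul]
      simp [coeff_egf, eulerianPoly_zero, eulerianPoly_one]
    | succ n ih =>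
      have h := congrArg (PowerSeries.coeff n) hLN
      have hs : (1 - t) * coeffDerivative N = PowerSeries.C (1 - X) * coeffDerivative N := by
        rw [hC]
      have hs' : (1 + t) * N = N + t * N := by ring
      have hX : PowerSeries.coeff n (PowerSeries.X * d N) = 0 := by
        cases n with
        | zero => simp
        | succ n =>
          rw [mul_comm, PowerSeries.coeff_succ_mul_X, PowerSeries.coeff_derivative, ih, zero_mul]
      rw [hs, hs', map_add, map_add, map_add, ht, PowerSeries.coeff_C_mul, PowerSeries.coeff_C_mul,
        PowerSeries.coeff_C_mul, PowerSeries.coeff_C_mul, hX, coeff_coeffDerivative, ih,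
        PowerSeries.coeff_derivative] at h
      simp only [derivative_zero, mul_zero, add_zero] at h
      have hn : (n : ℝ[X]) + 1 ≠ 0 := by exact_mod_cast n.succ_ne_zero
      exact (mul_eq_zero.1 h).resolve_right hn
  have hN0 : N = 0 := PowerSeries.ext fun n => by rw [hzero]; simp
  linear_combination hN0

theorem qBinom_zero_right (n : ℕ) : qBinom n 0 = 1 := by
  have h := qBinom_mul (Nat.zero_le n)
  exact mul_right_cancel₀ (qPoch_ne_zero n) (by simpa [qPoch] using h)

theorem qBinom_self (n : ℕ) : qBinom n n = 1 := by
  have h := qBinom_mul (le_refl n)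
  exact mul_right_cancel₀ (qPoch_ne_zero n) (by simpa [qPoch] using h)

theorem qBinom_succ_succ {n m : ℕ} (h : m < n) :
    qBinom (n + 1) (m + 1) = qBinom n (m + 1) + X ^ (n - m) * qBinom n m := by
  obtain ⟨l, rfl⟩ : ∃ l, n = m + 1 + l := ⟨n - (m + 1), by omega⟩
  have h1 := qBinom_mul (n := m + 1 + l + 1) (m := m + 1) (by omega)
  have h2 := qBinom_mul (n := m + 1 + l) (m := m + 1) (by omega)
  have h3 := qBinom_mul (n := m + 1 + l) (m := m) (by omega)
  have e1 : m + 1 + l + 1 - (m + 1) = l + 1 := by omega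
  have e2 : m + 1 + l - (m + 1) = l := by omega
  have e3 : m + 1 + l - m = l + 1 := by omega
  rw [e1] at h1
  rw [e2] at h2
  rw [e3] at h3 ⊢
  refine mul_right_cancel₀ (mul_ne_zero (qPoch_ne_zero (m + 1)) (qPoch_ne_zero (l + 1))) ?_
  rw [h1, add_mul]
  have h2' : qBinom (m + 1 + l) (m + 1) * (qPoch (m + 1) * qPoch (l + 1)) =
      qPoch (m + 1 + l) * (1 - X ^ (l + 1)) := by
    rw [qPoch_succ l, ← h2]; ring
  have h3' : qBinom (m + 1 + l) m * (qPoch (m + 1) * qPoch (l + 1)) =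
      qPoch (m + 1 + l) * (1 - X ^ (m + 1)) := by
    rw [qPoch_succ m, ← h3]; ring
  rw [h2', mul_assoc, h3', qPoch_succ]
  ring

/-- The `q`-binomial coefficients at `q = -1`. -/
theorem eval_neg_one_qBinom {n m : ℕ} (h : m ≤ n) :
    (qBinom n m).eval (-1) =
      if Even n ∧ Odd m then 0 else ((n / 2).choose (m / 2) : ℝ) := by
  induction n generalizing m with
  | zero =>
    obtain rfl : m = 0 := by omega
    simp [qBinom_zero_right]
  | succ n ih =>
    rcases m with _ | m
    · simp [qBinom_zero_right]
    rcases (Nat.lt_or_ge m n) with hm | hm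
    · rw [qBinom_succ_succ hm, eval_add, eval_mul, eval_pow, eval_X, ih hm, ih hm.le]
      have hs : ((-1 : ℝ)) ^ (n - m) = (-1) ^ n * (-1) ^ m := by
        rw [← pow_add, show n + m = (n - m) + 2 * m by omega, pow_add, pow_mul]; simp
      rw [hs]
      rcases Nat.even_or_odd' n with ⟨a, rfl | rfl⟩ <;>
        rcases Nat.even_or_odd' m with ⟨b, rfl | rfl⟩
      · have e1 : (2 * a + 1) / 2 = a := by omega
        have e2 : (2 * b + 1) / 2 = b := by omega
        simp [e1, e2, pow_mul, parity_simps]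
      · have e1 : (2 * a + 1) / 2 = a := by omega
        have e2 : (2 * b + 1 + 1) / 2 = b + 1 := by omega
        simp [e1, e2, parity_simps]
      · have e1 : (2 * a + 1 + 1) / 2 = a + 1 := by omega
        have e2 : (2 * b + 1) / 2 = b := by omega
        have e3 : (2 * a + 1) / 2 = a := by omega
        simp [e2, e3, parity_simps, pow_succ, pow_mul]
      · have e1 : (2 * a + 1 + 1) / 2 = a + 1 := by omega
        have e2 : (2 * b + 1) / 2 = b := by omega
        have e3 : (2 * a + 1) / 2 = a := by omega
        have e4 : (2 * b + 1 + 1) / 2 = b + 1 := by omega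
        have o : Odd (2 * a + 1) := odd_two_mul_add_one a
        have o' : Odd (2 * b + 1) := odd_two_mul_add_one b
        have c1 : ¬ (Even (2 * a + 1) ∧ Odd (2 * b + 1 + 1)) := fun h =>
          Nat.not_even_iff_odd.2 o h.1
        have c2 : ¬ (Even (2 * a + 1) ∧ Odd (2 * b + 1)) := fun h =>
          Nat.not_even_iff_odd.2 o h.1
        have c3 : ¬ (Even (2 * a + 1 + 1) ∧ Odd (2 * b + 1 + 1)) := fun h =>
          Nat.not_odd_iff_even.2 o'.add_one h.2
        rw [if_neg c1, if_neg c2, if_neg c3, e1, e2, e3, e4, o.neg_one_pow, o'.neg_one_pow,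
          Nat.choose_succ_succ]
        push_cast
        ring
    · obtain rfl : n = m := by omega
      simp only [qBinom_self, eval_one, Nat.choose_self, Nat.cast_one]
      rw [if_neg (fun h => Nat.not_even_iff_odd.2 h.2 h.1)]

/-- Let the pairs of positions `p j`, `q j` be disjoint and let the weight of a permutation be a
product of weights of the pairs of values at these positions. If exchanging the two values of a pair
cancels the weights unless one of the values is `q j`, then the sum of all weights reduces to the
permutations that fix every `q j`. -/
theorem sum_perm_prod_pairs {α ι R : Type*} [Fintype α] [DecidableEq α] [DecidableEq ι]
    [CommRing R] (p q : ι → α) (hp : Function.Injective p) (hq : Function.Injective q)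
    (hpq : ∀ i j, p i ≠ q j) (w : ι → α → α → R) (g : ι → α → R)
    (hw : ∀ j a b, a ≠ b → a ≠ q j → b ≠ q j → w j a b + w j b a = 0)
    (hg : ∀ j b, b ≠ q j → w j b (q j) + w j (q j) b = g j b) (u s : Finset ι) (hs : s ⊆ u) :
    ∑ π : Equiv.Perm α, ∏ j ∈ u, w j (π (p j)) (π (q j)) =
      ∑ π : Equiv.Perm α with ∀ j ∈ s, π (q j) = q j,
        (∏ j ∈ s, g j (π (p j))) * ∏ j ∈ u \ s, w j (π (p j)) (π (q j)) := by
  induction s using Finset.induction_on with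
  | empty => simp
  | insert k s hk ih =>
    rw [ih ((Finset.subset_insert k s).trans hs)]
    have hku : k ∈ u := hs (Finset.mem_insert_self k s)
    set T : Finset (Equiv.Perm α) := {π | ∀ j ∈ s, π (q j) = q j} with hT
    set τ := Equiv.swap (p k) (q k) with hτ
    set r : Equiv.Perm α → R := fun π =>
      (∏ j ∈ s, g j (π (p j))) * ∏ j ∈ u \ insert k s, w j (π (p j)) (π (q j)) with hr
    have hτp : ∀ j, j ≠ k → τ (p j) = p j := fun j hj =>
      Equiv.swap_apply_of_ne_of_ne (fun h => hj (hp h)) (hpq _ _)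
    have hτq : ∀ j, j ≠ k → τ (q j) = q j := fun j hj =>
      Equiv.swap_apply_of_ne_of_ne (hpq _ _).symm (fun h => hj (hq h))
    have hτpk : τ (p k) = q k := Equiv.swap_apply_left _ _
    have hτqk : τ (q k) = p k := Equiv.swap_apply_right _ _
    have hττ : ∀ π : Equiv.Perm α, π * τ * τ = π := fun π => by
      rw [mul_assoc, hτ, Equiv.swap_mul_self, mul_one]
    have hne : ∀ j ∈ s, j ≠ k := fun j hj h => hk (h ▸ hj)
    have hrτ : ∀ π, r (π * τ) = r π := by
      intro π
      simp only [hr, Equiv.Perm.mul_apply]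
      congr 1
      · exact Finset.prod_congr rfl fun j hj => by rw [hτp j (hne j hj)]
      · refine Finset.prod_congr rfl fun j hj => ?_
        have hjk : j ≠ k := by
          rintro rfl; exact (Finset.mem_sdiff.1 hj).2 (Finset.mem_insert_self _ _)
        rw [hτp j hjk, hτq j hjk]
    have hTτ : ∀ π, π ∈ T → π * τ ∈ T := by
      intro π hπ
      simp only [hT, Finset.mem_filter, Finset.mem_univ, true_and, Equiv.Perm.mul_apply] at hπ ⊢
      exact fun j hj => by rw [hτq j (hne j hj), hπ j hj]
    have hterm : ∀ π : Equiv.Perm α, (∏ j ∈ s, g j (π (p j))) *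
        ∏ j ∈ u \ s, w j (π (p j)) (π (q j)) = w k (π (p k)) (π (q k)) * r π := by
      intro π
      have : u \ s = insert k (u \ insert k s) := by
        ext j; by_cases hj : j = k <;> simp_all
      rw [this, Finset.prod_insert (by simp)]
      simp only [hr]; ring
    have hRHS : ∀ π : Equiv.Perm α, (∏ j ∈ insert k s, g j (π (p j))) *
        ∏ j ∈ u \ insert k s, w j (π (p j)) (π (q j)) = g k (π (p k)) * r π := by
      intro π
      rw [Finset.prod_insert hk]
      simp only [hr]; ring
    simp_rw [hterm, hRHS]
    have hfilter : (Finset.univ.filter fun π : Equiv.Perm α => ∀ j ∈ insert k s, π (q j) = q j) =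
        T.filter fun π => π (q k) = q k := by
      ext π; simp [hT, and_comm]
    rw [hfilter, ← Finset.sum_filter_add_sum_filter_not T fun π => π (q k) = q k,
      ← Finset.sum_filter_add_sum_filter_not (T.filter fun π => ¬ π (q k) = q k)
        fun π => π (p k) = q k]
    have hzero : ∑ π ∈ (T.filter fun π => ¬ π (q k) = q k) with ¬ π (p k) = q k,
        w k (π (p k)) (π (q k)) * r π = 0 := by
      refine Finset.sum_involution (fun π _ => π * τ) ?_ ?_ ?_ ?_
      · intro π hπ
        simp only [Finset.mem_filter] at hπ
        rw [hrτ, Equiv.Perm.mul_apply, Equiv.Perm.mul_apply, hτpk, hτqk, ← add_mul,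
          hw k _ _ (fun h => hpq k k (π.injective h)) hπ.2 hπ.1.2, zero_mul]
      · intro π _ _ h
        have := congrArg (fun σ : Equiv.Perm α => σ (p k)) h
        simp only [Equiv.Perm.mul_apply, hτpk] at this
        exact hpq k k (π.injective this).symm
      · intro π hπ
        simp only [Finset.mem_filter, Equiv.Perm.mul_apply, hτpk, hτqk] at hπ ⊢
        exact ⟨⟨hTτ π hπ.1.1, hπ.2⟩, hπ.1.2⟩
      · intro π _; exact hττ π
    have hswap : ∑ π ∈ (T.filter fun π => ¬ π (q k) = q k) with π (p k) = q k,
        w k (π (p k)) (π (q k)) * r π =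
        ∑ π ∈ T with π (q k) = q k, w k (π (q k)) (π (p k)) * r π := by
      refine Finset.sum_nbij' (fun π => π * τ) (fun π => π * τ) ?_ ?_ ?_ ?_ ?_
      · intro π hπ
        simp only [Finset.mem_filter, Equiv.Perm.mul_apply, hτqk] at hπ ⊢
        exact ⟨hTτ π hπ.1.1, hπ.2⟩
      · intro π hπ
        simp only [Finset.mem_filter, Equiv.Perm.mul_apply, hτpk, hτqk] at hπ ⊢
        exact ⟨⟨hTτ π hπ.1, fun h => hpq k k (π.injective (h.trans hπ.2.symm))⟩, hπ.2⟩
      · intro π _; exact hττ π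
      · intro π _; exact hττ π
      · intro π _
        rw [hrτ, Equiv.Perm.mul_apply, Equiv.Perm.mul_apply, hτpk, hτqk]
    rw [hzero, add_zero, hswap, ← Finset.sum_add_distrib]
    refine Finset.sum_congr rfl fun π hπ => ?_
    have hπq := (Finset.mem_filter.1 hπ).2
    rw [← add_mul, hπq, hg k _ fun h => hpq k k (π.injective (h.trans hπq.symm))]

/-- The even elements of `Fin n`. -/
def finEvenEquiv (n : ℕ) : Fin ((n + 1) / 2) ≃ {i : Fin n // Even (i : ℕ)} where
  toFun j := ⟨⟨2 * j, by omega⟩, by simp⟩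
  invFun i := ⟨(i : Fin n) / 2, by omega⟩
  left_inv j := by ext; simp
  right_inv i := by
    ext; simp only; have := i.2; exact Nat.mul_div_cancel' this.two_dvd

theorem prod_fin_eq_prod_pairs {R : Type*} [CommMonoid R] (n : ℕ) (f : Fin n → R)
    (hf : ∀ i : Fin n, Even (i : ℕ) → (i : ℕ) + 1 = n → f i = 1) :
    ∏ i, f i =
      ∏ j : Fin (n / 2), f ⟨2 * j, by omega⟩ * f ⟨2 * j + 1, by omega⟩ := by
  obtain ⟨F, hF⟩ : ∃ F : ℕ → R, ∀ i (h : i < n), F i = f ⟨i, h⟩ :=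
    ⟨fun i => if h : i < n then f ⟨i, h⟩ else 1, fun i h => dif_pos h⟩
  have h : ∀ m, ∏ i ∈ Finset.range (2 * m), F i =
      ∏ j ∈ Finset.range m, F (2 * j) * F (2 * j + 1) := by
    intro m
    induction m with
    | zero => simp
    | succ m ih =>
      rw [Finset.prod_range_succ, ← ih, show 2 * (m + 1) = 2 * m + 1 + 1 by ring,
        Finset.prod_range_succ, Finset.prod_range_succ, mul_assoc]
  have h1 : ∏ i, f i = ∏ i ∈ Finset.range n, F i := by
    rw [← Fin.prod_univ_eq_prod_range]
    exact Finset.prod_congr rfl fun i _ => (hF i i.2).symm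
  have h2 : ∏ j : Fin (n / 2), f ⟨2 * j, by omega⟩ * f ⟨2 * j + 1, by omega⟩ =
      ∏ j ∈ Finset.range (n / 2), F (2 * j) * F (2 * j + 1) := by
    rw [← Fin.prod_univ_eq_prod_range fun j => F (2 * j) * F (2 * j + 1)]
    exact Finset.prod_congr rfl fun j _ => by rw [hF _ (by omega), hF _ (by omega)]
  rw [h1, h2, ← h]
  rcases Nat.even_or_odd' n with ⟨m, hm | hm⟩
  · rw [show 2 * (n / 2) = n by omega]
  · rw [show Finset.range n = Finset.range (2 * (n / 2) + 1) by congr 1; omega,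
      Finset.prod_range_succ, hF _ (by omega), hf _ (by simp) (by simp only; omega), mul_one]

theorem sum_filter_eq_sum_subtype {α M : Type*} [Fintype α] [AddCommMonoid M] {P Q : α → Prop}
    {_ : DecidablePred P} [Fintype {x // Q x}] (h : ∀ x, P x ↔ Q x) (f : α → M) :
    ∑ x with P x, f x = ∑ x : {x // Q x}, f x :=
  Finset.sum_subtype _ (by simp [h]) f

theorem prod_fin_castLE {R : Type*} [CommMonoid R] {m n : ℕ} (h : m ≤ n) (f : Fin n → R)
    (hf : ∀ i : Fin n, m ≤ i → f i = 1) :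
    ∏ j : Fin m, f (Fin.castLE h j) = ∏ i, f i := by
  refine Finset.prod_of_injOn (Fin.castLE h) (Fin.castLE_injective h).injOn (by simp) ?_
    fun _ _ => rfl
  intro i _ hi
  refine hf i (not_lt.1 fun him => hi ⟨⟨i, him⟩, by simp, rfl⟩)

theorem neg_one_pow_maj {n : ℕ} (π : Equiv.Perm (Fin n)) :
    (-1 : ℝ[X]) ^ maj π =
      ∏ j : Fin (n / 2), if π ⟨2 * j + 1, by omega⟩ < π ⟨2 * j, by omega⟩ then -1 else 1 := by
  have h : (-1 : ℝ[X]) ^ maj π =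
      ∏ i : Fin n, if i ∈ descentSet π then (-1) ^ ((i : ℕ) + 1) else 1 := by
    rw [maj, ← Finset.prod_pow_eq_pow_sum, Finset.prod_ite_mem, Finset.univ_inter]
  rw [h, prod_fin_eq_prod_pairs]
  · refine Finset.prod_congr rfl fun j _ => ?_
    have hj : 2 * (j : ℕ) + 1 < n := by omega
    have e1 : (-1 : ℝ[X]) ^ (2 * (j : ℕ) + 1) = -1 := by simp [pow_succ]
    have e2 : (-1 : ℝ[X]) ^ (2 * (j : ℕ) + 1 + 1) = 1 := by simp [pow_succ]
    simp [descentSet, e1, e2, hj]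
  · intro i _ hi
    rw [if_neg]
    simp [descentSet, hi]

theorem pow_exc {R : Type*} [CommMonoid R] {n : ℕ} (x : R) (π : Equiv.Perm (Fin n)) :
    x ^ exc π =
      ∏ j : Fin (n / 2), (if (⟨2 * j, by omega⟩ : Fin n) < π ⟨2 * j, by omega⟩ then x else 1) *
        if (⟨2 * j + 1, by omega⟩ : Fin n) < π ⟨2 * j + 1, by omega⟩ then x else 1 := by
  rw [← prod_fin_eq_prod_pairs n fun i => if i < π i then x else 1]
  · rw [exc, ← Finset.prod_const, Finset.prod_filter]
  · intro i _ hi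
    rw [if_neg]
    have := (π i).2
    rw [Fin.lt_def]; omega

theorem signedEulerian_eq_sum (n : ℕ) :
    signedEulerian n = ∑ π : Equiv.Perm (Fin n), (-X) ^ exc π * (-1) ^ maj π := by
  rw [signedEulerian, qEulerian, Polynomial.map_sum]
  refine Finset.sum_congr rfl fun π _ => ?_
  obtain ⟨d, hd⟩ := Nat.exists_eq_add_of_le (exc_le_maj π)
  have h2 : (-1 : ℝ[X]) ^ exc π * (-1) ^ exc π = 1 := by rw [← mul_pow]; simp
  rw [hd, Nat.add_sub_cancel_left, neg_pow, pow_add]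
  simp
  linear_combination (-(-1) ^ d * X ^ exc π) * h2

/-- At `q = -1` the `(maj, exc)`-Eulerian polynomials reduce to Eulerian polynomials. -/
theorem signedEulerian_eq (n : ℕ) :
    signedEulerian n = (1 + X) ^ (n / 2) * eulerianPoly ((n + 1) / 2) := by
  rw [signedEulerian_eq_sum]
  let p : Fin (n / 2) → Fin n := fun j => ⟨2 * j, by omega⟩
  let q : Fin (n / 2) → Fin n := fun j => ⟨2 * j + 1, by omega⟩
  let w : Fin (n / 2) → Fin n → Fin n → ℝ[X] := fun j a b =>
    (if p j < a then -X else 1) * (if q j < b then -X else 1) * (if b < a then -1 else 1)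
  let g : Fin (n / 2) → Fin n → ℝ[X] := fun j b => (1 + X) * (if p j < b then X else 1)
  have hpq : ∀ i j, p i ≠ q j := fun i j h => by
    have := congrArg Fin.val h
    simp only [p, q] at this; omega
  have key := sum_perm_prod_pairs p q
    (fun i j h => by have := congrArg Fin.val h; simp only [p] at this; omega)
    (fun i j h => by have := congrArg Fin.val h; simp only [q] at this; omega)
    hpq w g ?_ ?_ Finset.univ Finset.univ (Finset.Subset.refl _)
  · have hL : ∀ π : Equiv.Perm (Fin n), (-X) ^ exc π * (-1) ^ maj π =
        ∏ j, w j (π (p j)) (π (q j)) := fun π => by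
      rw [pow_exc, neg_one_pow_maj, ← Finset.prod_mul_distrib]
    simp_rw [hL]
    rw [key, eulerianPoly, Finset.mul_sum]
    have hfix : ∀ π : Equiv.Perm (Fin n), (∀ j ∈ Finset.univ, π (q j) = q j) ↔
        ∀ a : Fin n, ¬ Even (a : ℕ) → π a = a := by
      intro π
      constructor
      · intro h a ha
        obtain ⟨k, hk⟩ := Nat.not_even_iff_odd.1 ha
        have := h ⟨k, by omega⟩ (Finset.mem_univ _)
        have e : q ⟨k, by omega⟩ = a := Fin.ext hk.symm
        rwa [e] at this
      · intro h j _
        exact h _ (by simp [q])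
    refine (sum_filter_eq_sum_subtype hfix _).trans ?_
    simp_rw [Finset.sdiff_self, Finset.prod_empty, mul_one]
    rw [← Equiv.sum_comp
      (Equiv.Perm.subtypeEquivSubtypePerm fun a : Fin n => Even (a : ℕ)),
      ← Equiv.sum_comp (finEvenEquiv n).permCongr]
    refine Finset.sum_congr rfl fun σ _ => ?_
    simp only [g]
    rw [Finset.prod_mul_distrib, Finset.prod_const, Finset.card_univ, Fintype.card_fin]
    congr 1
    have hval : ∀ j : Fin (n / 2),
        (Equiv.Perm.ofSubtype ((finEvenEquiv n).permCongr σ) (p j) : ℕ) =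
          2 * (σ (Fin.castLE (by omega) j) : ℕ) := by
      intro j
      rw [Equiv.Perm.ofSubtype_apply_of_mem _ (by simp [p])]
      have : (finEvenEquiv n).symm ⟨p j, by simp [p]⟩ = Fin.castLE (by omega) j :=
        Fin.ext (by simp [finEvenEquiv, p])
      rw [Equiv.permCongr_apply, this]
      rfl
    have hexc : X ^ exc σ = ∏ i, if i < σ i then (X : ℝ[X]) else 1 := by
      rw [exc, ← Finset.prod_const, Finset.prod_filter]
    rw [hexc, ← prod_fin_castLE (m := n / 2) (by omega) fun i => if i < σ i then (X : ℝ[X]) else 1]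
    · refine Finset.prod_congr rfl fun j _ => if_congr ?_ rfl rfl
      rw [Fin.lt_def, Fin.lt_def, Equiv.Perm.subtypeEquivSubtypePerm_apply_coe, hval]
      simp [p]
    · intro i hi
      rw [if_neg]
      have := (σ i).2
      rw [Fin.lt_def]; omega
  · intro j a b hab ha hb
    have ha' : p j < a ↔ q j < a := by
      have : (a : ℕ) ≠ q j := fun h => ha (Fin.ext h)
      simp only [Fin.lt_def, p, q] at this ⊢; omega
    have hb' : p j < b ↔ q j < b := by
      have : (b : ℕ) ≠ q j := fun h => hb (Fin.ext h)
      simp only [Fin.lt_def, p, q] at this ⊢; omega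
    simp only [w, ha', hb']
    rcases lt_or_gt_of_ne hab with h | h
    · rw [if_neg h.not_gt, if_pos h]; ring
    · rw [if_pos h, if_neg h.not_gt]; ring
  · intro j b hb
    have hb' : p j < b ↔ q j < b := by
      have : (b : ℕ) ≠ q j := fun h => hb (Fin.ext h)
      simp only [Fin.lt_def, p, q] at this ⊢; omega
    have hpq' : p j < q j := by simp [Fin.lt_def, p, q]
    simp only [w, g, hb', lt_self_iff_false, if_false, if_pos hpq']
    rcases lt_or_gt_of_ne hb with h | h
    · simp only [if_neg h.not_gt, if_pos h]; ring
    · simp only [if_pos h, if_neg h.not_gt]; ring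

theorem signedEulerian_two_mul (k : ℕ) :
    signedEulerian (2 * k) = (1 + X) ^ k * eulerianPoly k := by
  rw [signedEulerian_eq, show 2 * k / 2 = k by omega, show (2 * k + 1) / 2 = k by omega]

theorem signedEulerian_two_mul_add_one (k : ℕ) :
    signedEulerian (2 * k + 1) = (1 + X) ^ k * eulerianPoly (k + 1) := by
  rw [signedEulerian_eq, show (2 * k + 1) / 2 = k by omega,
    show (2 * k + 1 + 1) / 2 = k + 1 by omega]

theorem signedEulerian_zero : signedEulerian 0 = 1 := by
  simpa [eulerianPoly_zero] using signedEulerian_two_mul 0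

theorem sum_Icc_one_eq {M : Type*} [AddCommGroup M] (n : ℕ) (f : ℕ → M) :
    ∑ k ∈ Finset.Icc 1 n, f k = ∑ k ∈ Finset.range (n + 1), f k - f 0 := by
  rw [Finset.range_eq_Ico, Finset.sum_eq_sum_Ico_succ_bot n.succ_pos, add_sub_cancel_left]
  rfl

theorem sum_range_two_mul {M : Type*} [AddCommMonoid M] (n : ℕ) (f : ℕ → M) :
    ∑ k ∈ Finset.range (2 * n), f k = ∑ k ∈ Finset.range n, (f (2 * k) + f (2 * k + 1)) := by
  induction n with
  | zero => simp
  | succ n ih =>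
    rw [Finset.sum_range_succ, ← ih, show 2 * (n + 1) = 2 * n + 1 + 1 by ring,
      Finset.sum_range_succ, Finset.sum_range_succ, add_assoc]

theorem signedBinomEulerian_eq (n : ℕ) :
    signedBinomEulerian n = 1 - X + X * ∑ m ∈ Finset.range (n + 1),
      (if Even n ∧ Odd m then 0 else ((n / 2).choose (m / 2) : ℝ[X])) * signedEulerian m := by
  have h : signedBinomEulerian n = 1 + X * ∑ m ∈ Finset.Icc 1 n,
      (if Even n ∧ Odd m then 0 else ((n / 2).choose (m / 2) : ℝ[X])) * signedEulerian m := by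
    rw [signedBinomEulerian, qBinomEulerian, Polynomial.map_add, Polynomial.map_mul,
      Polynomial.map_sum, Polynomial.map_one, map_X]
    congr 2
    refine Finset.sum_congr rfl fun m hm => ?_
    rw [Polynomial.map_mul, map_C, coe_evalRingHom, eval_neg_one_qBinom (Finset.mem_Icc.1 hm).2,
      signedEulerian]
    split_ifs <;> simp
  rw [h, sum_Icc_one_eq]
  simp [signedEulerian_zero]
  ring

theorem signedBinomEulerian_two_mul (n : ℕ) :
    signedBinomEulerian (2 * n) = 1 - X +
      X * ∑ k ∈ Finset.range (n + 1), (n.choose k : ℝ[X]) * signedEulerian (2 * k) * 1 := by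
  have h : ∀ f : ℕ → ℝ[X], f (2 * n + 1) = 0 →
      ∑ m ∈ Finset.range (2 * n + 1), f m = ∑ m ∈ Finset.range (2 * (n + 1)), f m := by
    intro f hf
    rw [show 2 * (n + 1) = 2 * n + 1 + 1 by ring, Finset.sum_range_succ _ (2 * n + 1), hf, add_zero]
  rw [signedBinomEulerian_eq, h _ (by simp), sum_range_two_mul]
  congr 2
  refine Finset.sum_congr rfl fun k _ => ?_
  simp

theorem signedBinomEulerian_two_mul_add_one (n : ℕ) :
    signedBinomEulerian (2 * n + 1) = signedBinomEulerian (2 * n) +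
      X * ∑ k ∈ Finset.range (n + 1), (n.choose k : ℝ[X]) * signedEulerian (2 * k + 1) * 1 := by
  rw [signedBinomEulerian_eq, signedBinomEulerian_two_mul,
    show 2 * n + 1 + 1 = 2 * (n + 1) by ring, sum_range_two_mul, add_assoc, ← mul_add,
    ← Finset.sum_add_distrib]
  congr 2
  refine Finset.sum_congr rfl fun k _ => ?_
  have hn : ¬ Even (2 * n + 1) := by simp
  rw [if_neg fun h => hn h.1, if_neg fun h => hn h.1, show (2 * n + 1) / 2 = n by omega,
    show 2 * k / 2 = k by omega, show (2 * k + 1) / 2 = k by omega, mul_one, mul_one]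

theorem egf_signedEulerian_odd :
    egf (fun n => signedEulerian (2 * n + 1)) =
      PowerSeries.C (1 - X) * egf (fun n => signedEulerian (2 * n)) +
        PowerSeries.C X *
          (egf (fun n => signedEulerian (2 * n)) * egf fun n => signedEulerian (2 * n)) := by
  have h : (fun n => eulerianPoly (n + 1)) = fun n => (1 - X) * eulerianPoly n + X *
      ∑ k ∈ Finset.range (n + 1), (n.choose k : ℝ[X]) * eulerianPoly k * eulerianPoly (n - k) := by
    apply egf_injective
    rw [← derivative_egf, derivative_egf_eulerianPoly, egf_add, egf_const_mul, egf_const_mul,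
      ← egf_mul, sq]
  rw [egf_mul, ← egf_const_mul, ← egf_const_mul, ← egf_add]
  congr 1
  funext n
  rw [signedEulerian_two_mul_add_one, congrFun h n, signedEulerian_two_mul, mul_add,
    mul_left_comm, mul_left_comm _ X, Finset.mul_sum]
  congr 2
  refine Finset.sum_congr rfl fun k hk => ?_
  obtain ⟨l, rfl⟩ := Nat.exists_eq_add_of_le (Nat.lt_succ_iff.1 (Finset.mem_range.1 hk))
  rw [signedEulerian_two_mul, signedEulerian_two_mul, Nat.add_sub_cancel_left, pow_add]
  ring

theorem derivative_egf_signedEulerian_even :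
    PowerSeries.derivative ℝ[X] (egf fun n => signedEulerian (2 * n)) =
      PowerSeries.C (1 + X) * egf fun n => signedEulerian (2 * n + 1) := by
  rw [derivative_egf, ← egf_const_mul]
  congr 1
  funext n
  rw [signedEulerian_two_mul, signedEulerian_two_mul_add_one, pow_succ]
  ring

theorem egf_signedBinomEulerian_even :
    egf (fun n => signedBinomEulerian (2 * n)) =
      PowerSeries.C (1 - X) * egf (fun _ => 1) +
        PowerSeries.C X * (egf (fun n => signedEulerian (2 * n)) * egf fun _ => 1) := by
  rw [egf_mul, ← egf_const_mul, ← egf_const_mul, ← egf_add]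
  congr 1
  funext n
  rw [signedBinomEulerian_two_mul, mul_one]

theorem egf_signedBinomEulerian_odd :
    egf (fun n => signedBinomEulerian (2 * n + 1)) =
      egf (fun n => signedBinomEulerian (2 * n)) +
        PowerSeries.C X * (egf (fun n => signedEulerian (2 * n + 1)) * egf fun _ => 1) := by
  rw [egf_mul, ← egf_const_mul, ← egf_add]
  congr 1
  funext n
  rw [signedBinomEulerian_two_mul_add_one]

theorem egf_signedBinomEulerian_odd_recurrence :
    egf (fun n => signedBinomEulerian (2 * n + 1)) =
      egf (fun n => signedBinomEulerian (2 * n)) + PowerSeries.C X *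
        (egf (fun n => signedEulerian (2 * n)) * egf fun n => signedBinomEulerian (2 * n)) := by
  rw [egf_signedBinomEulerian_odd, egf_signedEulerian_odd, egf_signedBinomEulerian_even]
  simp only [map_sub, map_one]
  ring

theorem egf_signedBinomEulerian_even_recurrence :
    egf (fun n => signedBinomEulerian (2 * n + 2)) =
      egf (fun n => signedBinomEulerian (2 * n + 1)) +
        PowerSeries.C X *
          (egf (fun n => signedEulerian (2 * n)) * egf fun n => signedBinomEulerian (2 * n + 1)) -
        PowerSeries.C X *
          (egf (fun n => signedEulerian (2 * n + 1)) *
            egf fun n => signedBinomEulerian (2 * n)) := by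
  have hd : egf (fun n => signedBinomEulerian (2 * n + 2)) =
      PowerSeries.derivative ℝ[X] (egf fun n => signedBinomEulerian (2 * n)) := by
    rw [derivative_egf]; rfl
  have hodd := egf_signedEulerian_odd
  have he : PowerSeries.derivative ℝ[X] (egf fun _ => 1) = egf fun _ => 1 := derivative_egf _
  rw [hd, egf_signedBinomEulerian_odd, egf_signedBinomEulerian_even, map_add,
    derivative_powerSeries_mul, derivative_powerSeries_mul, derivative_powerSeries_mul, he,
    derivative_egf_signedEulerian_even, PowerSeries.derivative_C, PowerSeries.derivative_C]
  simp only [map_sub, map_add, map_one] at hodd ⊢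
  set t : PowerSeries ℝ[X] := PowerSeries.C X
  set a := egf fun n => signedEulerian (2 * n)
  set e := egf fun _ => 1
  linear_combination (t * e) * hodd
end

theorem corollary2p4 (n : ℕ) :
    signedBinomEulerian (2 * n + 1) =
        (1 + X) * signedBinomEulerian (2 * n) +
          X * ∑ k ∈ Finset.Icc 1 n,
            (n.choose k : ℝ[X]) * signedEulerian (2 * k) *
              signedBinomEulerian (2 * n - 2 * k) ∧
      signedBinomEulerian (2 * n + 2) =
        (1 + X) * signedBinomEulerian (2 * n + 1) +
          X * ∑ k ∈ Finset.Icc 1 n,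
            (n.choose k : ℝ[X]) * signedEulerian (2 * k) *
              signedBinomEulerian (2 * n + 1 - 2 * k) -
          X * ∑ k ∈ Finset.Icc 0 n,
            (n.choose k : ℝ[X]) * signedEulerian (2 * k + 1) *
              signedBinomEulerian (2 * n - 2 * k) := by
  constructor
  · have h := egf_signedBinomEulerian_odd_recurrence
    rw [egf_mul, ← egf_const_mul, ← egf_add] at h
    rw [sum_Icc_one_eq, congrFun (egf_injective h) n]
    simp only [Nat.mul_sub, mul_zero, Nat.sub_zero, Nat.choose_zero_right, Nat.cast_one,
      signedEulerian_zero]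
    ring
  · have h := egf_signedBinomEulerian_even_recurrence
    rw [egf_mul, egf_mul, ← egf_const_mul, ← egf_const_mul, ← egf_add, ← egf_sub] at h
    have hk : ∑ k ∈ Finset.range (n + 1), (n.choose k : ℝ[X]) * signedEulerian (2 * k) *
          signedBinomEulerian (2 * n + 1 - 2 * k) =
        ∑ k ∈ Finset.range (n + 1), (n.choose k : ℝ[X]) * signedEulerian (2 * k) *
          signedBinomEulerian (2 * (n - k) + 1) := by
      refine Finset.sum_congr rfl fun k hk => ?_
      have := Finset.mem_range.1 hk
      rw [show 2 * n + 1 - 2 * k = 2 * (n - k) + 1 by omega]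
    have hIcc : Finset.Icc 0 n = Finset.range (n + 1) := by
      rw [Finset.range_eq_Ico]; rfl
    rw [sum_Icc_one_eq, hk, hIcc, congrFun (egf_injective h) n]
    simp only [Nat.mul_sub, mul_zero, Nat.sub_zero, Nat.choose_zero_right, Nat.cast_one,
      signedEulerian_zero]
    ring
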